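/- Let $N$ be a positive integer and let $q$ be a complex number with $|q|<1$. Write $(q)_0=1$ and $(q)_n=(q;q)_n=(1-q)(1-q^2)\cdots(1-q^n)$ for $n\ge 1$, and let $\left[\begin{matrix} N\\ n\end{matrix}\right]=\frac{(q)_N}{(q)_n(q)_{N-n}}$ for $0\le n\le N$ denote the $q$-binomial coefficient. Then the infinite series on the right-hand side below converges absolutely, and $$\frac{1}{(q)_N}\sum_{n=1}^{N}\left[\begin{matrix} N\\ n\end{matrix}\right]\frac{(-1)^{n-1}\,n\,q^{n(n+1)/2}}{1-q^n}+\sum_{n=1}^{N}\left[\begin{matrix} N\\ n\end{matrix}\right]\frac{q^{n^2}}{(q)_n}\sum_{k=1}^{n}\frac{q^k}{(1-q^k)^2}=\frac{1}{(q)_N}\sum_{n=1}^{\infty}\frac{n\,q^n\,(1-q^{Nn})}{1-q^n}.$$ -/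

import Mathlib

/-- The `q`-shifted factorial `(A; q)_n = (1 - A)(1 - A q) ⋯ (1 - A q^(n-1))`, with `(A; q)_0 = 1`. -/
noncomputable def qShiftedFactorial (A q : ℂ) (n : ℕ) : ℂ :=
  ∏ i ∈ Finset.range n, (1 - A * q ^ i)

/-- The `q`-binomial coefficient: `(q; q)_N / ((q; q)_n (q; q)_(N-n))` if `0 ≤ n ≤ N`,
and `0` otherwise. -/
noncomputable def qBinomial (q : ℂ) (N n : ℕ) : ℂ :=
  if n ≤ N then
    qShiftedFactorial q q N / (qShiftedFactorial q q n * qShiftedFactorial q q (N - n))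
  else 0

/-! Multiply through by `(q)_N` and set `H_N = ∑_{k ≤ N} q^k/(1-q^k)^2`. The series on the right is
`H_N` (`hasSum_pnat_mul_pow_div`), so the claim is the finite identity
`qAlternatingSum_add_sum_qDurfeeWeight`, proved by induction on `N`. The alternating sum grows by
`q^(N+1) (q)_N/(1-q^(N+1))`, the Durfee sum by `q^(N+1) (1-(q)_(N+1))/(1-q^(N+1))^2`; the `(q)`
terms cancel and leave the increment of `H_N`. -/

/-- `(q; q)_(n+1) = (q; q)_n (1 - q^(n+1))`. -/
lemma qShiftedFactorial_self_succ (q : ℂ) (n : ℕ) :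
    qShiftedFactorial q q (n + 1) = qShiftedFactorial q q n * (1 - q ^ (n + 1)) := by
  simp [qShiftedFactorial, Finset.prod_range_succ, pow_succ']

lemma qShiftedFactorial_zero (A q : ℂ) : qShiftedFactorial A q 0 = 1 := by
  simp [qShiftedFactorial]

lemma one_sub_pow_succ_ne_zero {q : ℂ} (hq : ‖q‖ < 1) (n : ℕ) : 1 - q ^ (n + 1) ≠ 0 := by
  intro h
  have h1 : ‖q ^ (n + 1)‖ < 1 := by
    rw [norm_pow]
    exact pow_lt_one₀ (norm_nonneg q) hq n.succ_ne_zero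
  rw [← sub_eq_zero.mp h] at h1
  simp at h1

lemma qShiftedFactorial_self_ne_zero {q : ℂ} (hq : ‖q‖ < 1) (n : ℕ) :
    qShiftedFactorial q q n ≠ 0 := by
  induction n with
  | zero => simp [qShiftedFactorial_zero]
  | succ n ih =>
    rw [qShiftedFactorial_self_succ]
    exact mul_ne_zero ih (one_sub_pow_succ_ne_zero hq n)

lemma qBinomial_add (q : ℂ) (n m : ℕ) :
    qBinomial q (n + m) n =
      qShiftedFactorial q q (n + m) / (qShiftedFactorial q q n * qShiftedFactorial q q m) := by
  simp [qBinomial]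

lemma qBinomial_eq_zero (q : ℂ) {N n : ℕ} (h : N < n) : qBinomial q N n = 0 := by
  simp [qBinomial, h]

lemma qBinomial_zero_right {q : ℂ} (hq : ‖q‖ < 1) (N : ℕ) : qBinomial q N 0 = 1 := by
  simp [qBinomial, qShiftedFactorial_zero, qShiftedFactorial_self_ne_zero hq]

lemma qBinomial_self {q : ℂ} (hq : ‖q‖ < 1) (N : ℕ) : qBinomial q N N = 1 := by
  simp [qBinomial, qShiftedFactorial_zero, qShiftedFactorial_self_ne_zero hq]

lemma qBinomial_succ_succ_div {q : ℂ} (hq : ‖q‖ < 1) {N n : ℕ} (h : n ≤ N) :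
    qBinomial q (N + 1) (n + 1) / (1 - q ^ (N + 1)) = qBinomial q N n / (1 - q ^ (n + 1)) := by
  obtain ⟨m, rfl⟩ := Nat.exists_eq_add_of_le h
  have e : n + m + 1 = n + 1 + m := by ring
  rw [e, qBinomial_add, qBinomial_add, ← e, qShiftedFactorial_self_succ,
    qShiftedFactorial_self_succ]
  have h1 := one_sub_pow_succ_ne_zero hq n
  have h2 := one_sub_pow_succ_ne_zero hq (n + m)
  have h3 := qShiftedFactorial_self_ne_zero hq n
  have h4 := qShiftedFactorial_self_ne_zero hq m
  field_simp

/-- The `q`-Pascal rule. -/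
lemma qBinomial_succ_succ {q : ℂ} (hq : ‖q‖ < 1) {N n : ℕ} (h : n ≤ N) :
    qBinomial q (N + 1) (n + 1) = qBinomial q N (n + 1) + q ^ (N - n) * qBinomial q N n := by
  obtain ⟨m, rfl⟩ := Nat.exists_eq_add_of_le h
  rcases m with _ | m
  · rw [add_zero, qBinomial_self hq, qBinomial_self hq, qBinomial_eq_zero q (Nat.lt_succ_self n)]
    simp
  · have e : n + (m + 1) = n + 1 + m := by ring
    have e' : n + (m + 1) + 1 = n + 1 + (m + 1) := by ring
    rw [e', qBinomial_add, qBinomial_add, e, qBinomial_add, ← add_assoc,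
      qShiftedFactorial_self_succ q (n + 1 + m), qShiftedFactorial_self_succ q n,
      qShiftedFactorial_self_succ q m, ← e, Nat.add_sub_cancel_left]
    have h1 := one_sub_pow_succ_ne_zero hq n
    have h2 := one_sub_pow_succ_ne_zero hq m
    have h3 := qShiftedFactorial_self_ne_zero hq n
    have h4 := qShiftedFactorial_self_ne_zero hq m
    field_simp
    ring

/-! ### The alternating sum -/

/-- The coefficients `[N, n] (-1)^n q^(n(n-1)/2)` of the expansion of `(z; q)_N`. -/
noncomputable def qAlternatingTerm (q : ℂ) (N n : ℕ) : ℂ :=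
  qBinomial q N n * ((-1) ^ n * q ^ n.choose 2)

lemma qAlternatingTerm_succ_succ {q : ℂ} (hq : ‖q‖ < 1) (N n : ℕ) :
    qAlternatingTerm q (N + 1) (n + 1) =
      qAlternatingTerm q N (n + 1) - q ^ N * qAlternatingTerm q N n := by
  unfold qAlternatingTerm
  rcases le_or_gt n N with h | h
  · rw [qBinomial_succ_succ hq h, Nat.choose_succ_succ' n 1, Nat.choose_one_right]
    obtain ⟨m, rfl⟩ := Nat.exists_eq_add_of_le h
    rw [Nat.add_sub_cancel_left]
    ring
  · rw [qBinomial_eq_zero q h, qBinomial_eq_zero q (h.trans n.lt_succ_self),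
      qBinomial_eq_zero q (Nat.succ_lt_succ h)]
    simp

/-- This is `(z; q)_(N+1) = (z; q)_N (1 - z q^N)` under the linear functional `z^n ↦ f n`. -/
lemma sum_qAlternatingTerm_succ {q : ℂ} (hq : ‖q‖ < 1) (f : ℕ → ℂ) (N : ℕ) :
    ∑ n ∈ Finset.range (N + 2), qAlternatingTerm q (N + 1) n * f n =
      ∑ n ∈ Finset.range (N + 1), qAlternatingTerm q N n * f n -
        q ^ N * ∑ n ∈ Finset.range (N + 1), qAlternatingTerm q N n * f (n + 1) := by
  have h0 : qAlternatingTerm q (N + 1) 0 = qAlternatingTerm q N 0 := by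
    simp [qAlternatingTerm, qBinomial_zero_right hq]
  have h1 : ∑ n ∈ Finset.range (N + 1), qAlternatingTerm q N n * f n =
      ∑ n ∈ Finset.range (N + 2), qAlternatingTerm q N n * f n := by
    rw [Finset.sum_range_succ _ (N + 1)]
    simp [qAlternatingTerm, qBinomial_eq_zero q (Nat.lt_succ_self N)]
  rw [h1, Finset.sum_range_succ' _ (N + 1), Finset.sum_range_succ' _ (N + 1), h0,
    Finset.mul_sum, add_sub_right_comm, ← Finset.sum_sub_distrib]
  congr 1
  refine Finset.sum_congr rfl fun n _ => ?_
  rw [qAlternatingTerm_succ_succ hq]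
  ring

lemma sum_qAlternatingTerm {q : ℂ} (hq : ‖q‖ < 1) (N : ℕ) :
    ∑ n ∈ Finset.range (N + 2), qAlternatingTerm q (N + 1) n = 0 := by
  induction N with
  | zero =>
    simp [Finset.sum_range_succ, qAlternatingTerm, qBinomial_zero_right hq, qBinomial_self hq]
  | succ N ih =>
    have h := sum_qAlternatingTerm_succ hq (fun _ => 1) (N + 1)
    simp only [mul_one] at h
    rw [h, ih]
    simp

/-- The derivative at `z = 1` of the `q`-binomial expansion of `(z; q)_(N+1)`. -/
lemma sum_qAlternatingTerm_mul {q : ℂ} (hq : ‖q‖ < 1) (N : ℕ) :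
    ∑ n ∈ Finset.range (N + 2), qAlternatingTerm q (N + 1) n * (n : ℂ) =
      -qShiftedFactorial q q N := by
  induction N with
  | zero =>
    simp [Finset.sum_range_succ, qAlternatingTerm, qBinomial_self hq, qShiftedFactorial_zero]
  | succ N ih =>
    rw [sum_qAlternatingTerm_succ hq (fun n => (n : ℂ)) (N + 1), ih]
    simp only [Nat.cast_add, Nat.cast_one, mul_add, mul_one, Finset.sum_add_distrib]
    rw [ih, sum_qAlternatingTerm hq, qShiftedFactorial_self_succ]
    ring

/-- The partial sums `∑_{k ≤ n} q^k / (1 - q^k)^2`. -/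
noncomputable def qHarmonicTwo (q : ℂ) (n : ℕ) : ℂ :=
  ∑ k ∈ Finset.range n, q ^ (k + 1) / (1 - q ^ (k + 1)) ^ 2

lemma qHarmonicTwo_succ (q : ℂ) (n : ℕ) :
    qHarmonicTwo q (n + 1) = qHarmonicTwo q n + q ^ (n + 1) / (1 - q ^ (n + 1)) ^ 2 :=
  Finset.sum_range_succ _ _

/-- The alternating sum on the left-hand side, without its prefactor. -/
noncomputable def qAlternatingSum (q : ℂ) (N : ℕ) : ℂ :=
  ∑ n ∈ Finset.range N, qBinomial q N (n + 1) *
    ((-1) ^ n * ((n : ℂ) + 1) * q ^ ((n + 1) * (n + 2) / 2) / (1 - q ^ (n + 1)))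

lemma succ_mul_succ_succ_div_two (n : ℕ) :
    (n + 1) * (n + 2) / 2 = (n + 1).choose 2 + (n + 1) := by
  have h := Nat.choose_two_right (n + 2)
  rw [Nat.choose_succ_succ' (n + 1) 1, Nat.choose_one_right,
    Nat.add_sub_cancel (n := n + 1) (m := 1), mul_comm] at h
  rw [← h, add_comm]

/-- In the termwise difference, `q`-Pascal leaves `[N, n]/(1-q^(n+1))`; absorption moves the
denominator to `1-q^(N+1)`, free of `n`, and the derivative at `z = 1` remains. -/
lemma qAlternatingSum_succ {q : ℂ} (hq : ‖q‖ < 1) (N : ℕ) :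
    qAlternatingSum q (N + 1) = qAlternatingSum q N +
      q ^ (N + 1) * qShiftedFactorial q q N / (1 - q ^ (N + 1)) := by
  have h1 : qAlternatingSum q N = ∑ n ∈ Finset.range (N + 1), qBinomial q N (n + 1) *
      ((-1) ^ n * ((n : ℂ) + 1) * q ^ ((n + 1) * (n + 2) / 2) / (1 - q ^ (n + 1))) := by
    rw [Finset.sum_range_succ, qBinomial_eq_zero q N.lt_succ_self]
    simp [qAlternatingSum]
  have h2 := sum_qAlternatingTerm_mul hq N
  rw [Finset.sum_range_succ'] at h2
  simp only [Nat.cast_zero, mul_zero, add_zero] at h2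
  rw [← neg_eq_iff_eq_neg.mpr h2, ← sub_eq_iff_eq_add', h1, qAlternatingSum,
    ← Finset.sum_sub_distrib, ← Finset.sum_neg_distrib, Finset.mul_sum, Finset.sum_div]
  refine Finset.sum_congr rfl fun n hn => ?_
  have hn : n ≤ N := Nat.lt_succ_iff.mp (Finset.mem_range.mp hn)
  have h3 := qBinomial_succ_succ_div hq hn
  have h4 : q ^ (N + 1) = q ^ (N - n) * q ^ (n + 1) := by
    rw [← pow_add]
    congr 1
    omega
  rw [← sub_mul, qBinomial_succ_succ hq hn, add_sub_cancel_left, qAlternatingTerm,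
    succ_mul_succ_succ_div_two, pow_add q ((n + 1).choose 2)]
  push_cast
  calc _ = qBinomial q N n / (1 - q ^ (n + 1)) * (q ^ (N - n) * q ^ (n + 1)) *
        ((-1) ^ n * ((n : ℂ) + 1) * q ^ (n + 1).choose 2) := by ring
    _ = _ := by
      rw [← h3, ← h4]
      ring

/-! ### Durfee weights and telescoping -/

/-- The weights `(q)_N [N, n] q^(n²) / (q)_n`, which sum to one over `n`. -/
noncomputable def qDurfeeWeight (q : ℂ) (N n : ℕ) : ℂ :=
  qShiftedFactorial q q N * (qBinomial q N n * (q ^ (n ^ 2) / qShiftedFactorial q q n))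

/-- The telescoping companion of `qDurfeeWeight`. -/
noncomputable def qDurfeeCompanion (q : ℂ) (N n : ℕ) : ℂ :=
  qDurfeeWeight q N n * (1 - q ^ n) ^ 2 * q ^ (N - n) / (1 - q ^ N) ^ 2

lemma qDurfeeWeight_eq_zero (q : ℂ) {N n : ℕ} (h : N < n) : qDurfeeWeight q N n = 0 := by
  simp [qDurfeeWeight, qBinomial_eq_zero q h]

lemma qDurfeeWeight_zero_right {q : ℂ} (hq : ‖q‖ < 1) (N : ℕ) :
    qDurfeeWeight q N 0 = qShiftedFactorial q q N := by
  simp [qDurfeeWeight, qBinomial_zero_right hq, qShiftedFactorial_zero]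

lemma qDurfeeWeight_self {q : ℂ} (hq : ‖q‖ < 1) (N : ℕ) :
    qDurfeeWeight q N N = q ^ (N ^ 2) := by
  rw [qDurfeeWeight, qBinomial_self hq]
  field_simp [qShiftedFactorial_self_ne_zero hq N]

/-- A WZ pair: the change in `N` is a difference in `n`, so sums against `f` can be handled by Abel
summation. -/
lemma qDurfeeWeight_succ_sub {q : ℂ} (hq : ‖q‖ < 1) {N n : ℕ} (h : n ≤ N + 1) :
    qDurfeeWeight q (N + 1) n - qDurfeeWeight q N n =
      qDurfeeCompanion q (N + 1) n - qDurfeeCompanion q (N + 1) (n + 1) := by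
  rcases h.eq_or_lt with rfl | h
  · simp only [qDurfeeCompanion, qDurfeeWeight_eq_zero q N.lt_succ_self,
      qDurfeeWeight_eq_zero q (N + 1).lt_succ_self, tsub_self, pow_zero, mul_one]
    have := one_sub_pow_succ_ne_zero hq N
    field_simp
    simp
  · obtain ⟨m, rfl⟩ := Nat.exists_eq_add_of_le (Nat.lt_succ_iff.mp h)
    have e : n + m + 1 = n + (m + 1) := by ring
    have e' : n + m + 1 = n + 1 + m := by ring
    have b1 := qBinomial_add q n (m + 1)
    have b2 := qBinomial_add q (n + 1) m
    have s1 : n + m + 1 - n = m + 1 := by omega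
    have s2 : n + m + 1 - (n + 1) = m := by omega
    rw [← e, qShiftedFactorial_self_succ, qShiftedFactorial_self_succ] at b1
    rw [← e', qShiftedFactorial_self_succ, qShiftedFactorial_self_succ] at b2
    simp only [qDurfeeCompanion, qDurfeeWeight, b1, b2, qBinomial_add, s1, s2,
      qShiftedFactorial_self_succ]
    have h1 := one_sub_pow_succ_ne_zero hq n
    have h2 := one_sub_pow_succ_ne_zero hq m
    have h3 := one_sub_pow_succ_ne_zero hq (n + m)
    have h4 := qShiftedFactorial_self_ne_zero hq n
    have h5 := qShiftedFactorial_self_ne_zero hq m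
    have h6 := qShiftedFactorial_self_ne_zero hq (n + m)
    field_simp
    ring

lemma sum_range_sub_succ_mul (G f : ℕ → ℂ) (M : ℕ) :
    ∑ n ∈ Finset.range M, (G n - G (n + 1)) * f n =
      ∑ n ∈ Finset.range M, G (n + 1) * (f (n + 1) - f n) + G 0 * f 0 - G M * f M := by
  induction M with
  | zero => simp
  | succ M ih =>
    rw [Finset.sum_range_succ, Finset.sum_range_succ, ih]
    ring

lemma sum_qDurfeeWeight_succ_mul {q : ℂ} (hq : ‖q‖ < 1) (f : ℕ → ℂ) (N : ℕ) :
    ∑ n ∈ Finset.range (N + 2), qDurfeeWeight q (N + 1) n * f n =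
      ∑ n ∈ Finset.range (N + 1), qDurfeeWeight q N n * f n +
        ∑ n ∈ Finset.range (N + 1), qDurfeeCompanion q (N + 1) (n + 1) * (f (n + 1) - f n) := by
  have h1 : ∑ n ∈ Finset.range (N + 1), qDurfeeWeight q N n * f n =
      ∑ n ∈ Finset.range (N + 2), qDurfeeWeight q N n * f n := by
    rw [Finset.sum_range_succ _ (N + 1), qDurfeeWeight_eq_zero q N.lt_succ_self]
    simp
  have h3 : qDurfeeCompanion q (N + 1) 0 = 0 := by simp [qDurfeeCompanion]
  have h4 : qDurfeeCompanion q (N + 1) (N + 2) = 0 := by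
    simp [qDurfeeCompanion, qDurfeeWeight_eq_zero q (N + 1).lt_succ_self]
  have h2 := sum_range_sub_succ_mul (qDurfeeCompanion q (N + 1)) f (N + 2)
  rw [h3, h4, Finset.sum_range_succ (fun n => qDurfeeCompanion q (N + 1) (n + 1) * _), h4] at h2
  simp only [zero_mul, add_zero, sub_zero] at h2
  rw [h1, ← sub_eq_iff_eq_add', ← Finset.sum_sub_distrib, ← h2]
  refine Finset.sum_congr rfl fun n hn => ?_
  rw [← sub_mul, qDurfeeWeight_succ_sub hq (Nat.lt_succ_iff.mp (Finset.mem_range.mp hn))]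

lemma sum_qDurfeeWeight {q : ℂ} (hq : ‖q‖ < 1) (N : ℕ) :
    ∑ n ∈ Finset.range (N + 1), qDurfeeWeight q N n = 1 := by
  induction N with
  | zero => simp [qDurfeeWeight_zero_right hq, qShiftedFactorial_zero]
  | succ N ih =>
    have h := sum_qDurfeeWeight_succ_mul hq (fun _ => 1) N
    simpa [ih] using h

/-- The factor `(1-q^n)^2` of the companion cancels the denominator of the increment of
`qHarmonicTwo`, leaving a constant times the weights with `n ≥ 1`, whose total is `1-(q)_(N+1)`. -/
lemma sum_qDurfeeWeight_mul_qHarmonicTwo_succ {q : ℂ} (hq : ‖q‖ < 1) (N : ℕ) :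
    ∑ n ∈ Finset.range (N + 2), qDurfeeWeight q (N + 1) n * qHarmonicTwo q n =
      ∑ n ∈ Finset.range (N + 1), qDurfeeWeight q N n * qHarmonicTwo q n +
        q ^ (N + 1) / (1 - q ^ (N + 1)) ^ 2 * (1 - qShiftedFactorial q q (N + 1)) := by
  have hW := sum_qDurfeeWeight hq (N + 1)
  rw [Finset.sum_range_succ' _ (N + 1), qDurfeeWeight_zero_right hq,
    ← eq_sub_iff_add_eq] at hW
  rw [sum_qDurfeeWeight_succ_mul hq, ← hW, Finset.mul_sum]
  congr 1
  refine Finset.sum_congr rfl fun n hn => ?_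
  have hn : n ≤ N := Nat.lt_succ_iff.mp (Finset.mem_range.mp hn)
  have h4 : q ^ (N + 1) = q ^ (N + 1 - (n + 1)) * q ^ (n + 1) := by
    rw [← pow_add]
    congr 1
    omega
  have h1 := one_sub_pow_succ_ne_zero hq n
  have h2 := one_sub_pow_succ_ne_zero hq N
  rw [qHarmonicTwo_succ, add_sub_cancel_left, qDurfeeCompanion]
  -- Shields the denominators, so that `h4` splits only the numerator power.
  generalize 1 - q ^ (N + 1) = D at h2 ⊢
  rw [h4]
  field_simp

lemma qAlternatingSum_add_sum_qDurfeeWeight {q : ℂ} (hq : ‖q‖ < 1) (N : ℕ) :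
    qAlternatingSum q N + ∑ n ∈ Finset.range (N + 1), qDurfeeWeight q N n * qHarmonicTwo q n =
      qHarmonicTwo q N := by
  induction N with
  | zero => simp [qAlternatingSum, qHarmonicTwo]
  | succ N ih =>
    rw [qAlternatingSum_succ hq, sum_qDurfeeWeight_mul_qHarmonicTwo_succ hq, qHarmonicTwo_succ,
      ← ih, qShiftedFactorial_self_succ]
    have := one_sub_pow_succ_ne_zero hq N
    field_simp
    ring

/-- Expand `(1-q^(Nn))/(1-q^n)` as a finite geometric sum and sum over `n` first, using `∑ n x^n =
x/(1-x)^2`. -/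
lemma hasSum_pnat_mul_pow_div {q : ℂ} (hq : ‖q‖ < 1) (N : ℕ) :
    HasSum (fun n : ℕ+ =>
      ((n : ℕ) : ℂ) * q ^ (n : ℕ) * (1 - q ^ (N * (n : ℕ))) / (1 - q ^ (n : ℕ)))
      (qHarmonicTwo q N) := by
  have h1 : ∀ k ∈ Finset.range N, HasSum (fun n : ℕ+ => ((n : ℕ) : ℂ) * (q ^ (k + 1)) ^ (n : ℕ))
      (q ^ (k + 1) / (1 - q ^ (k + 1)) ^ 2) := by
    intro k _
    have hk : ‖q ^ (k + 1)‖ < 1 := by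
      rw [norm_pow]
      exact pow_lt_one₀ (norm_nonneg q) hq k.succ_ne_zero
    have h := hasSum_coe_mul_geometric_of_norm_lt_one hk
    refine (PNat.coe_injective.hasSum_iff fun n hn => ?_).mpr h
    rcases n with _ | n
    · simp
    · exact absurd ⟨n.succPNat, rfl⟩ hn
  rw [qHarmonicTwo]
  convert hasSum_sum h1 using 2 with n
  have hn : 1 - q ^ (n : ℕ) ≠ 0 := by
    rw [← PNat.natPred_add_one n]
    exact one_sub_pow_succ_ne_zero hq _
  have h2 := mul_neg_geom_sum (q ^ (n : ℕ)) N
  have h3 : ∑ k ∈ Finset.range N, ((n : ℕ) : ℂ) * (q ^ (k + 1)) ^ (n : ℕ) =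
      ((n : ℕ) : ℂ) * q ^ (n : ℕ) * ∑ k ∈ Finset.range N, (q ^ (n : ℕ)) ^ k := by
    rw [Finset.mul_sum]
    refine Finset.sum_congr rfl fun k _ => ?_
    ring
  rw [h3, mul_comm N, pow_mul, ← h2]
  field_simp

theorem mainTheorem5 (N : ℕ) (hN : 1 ≤ N) (q : ℂ) (hq : ‖q‖ < 1) :
    Summable (fun n : ℕ+ =>
      ((n : ℕ) : ℂ) * q ^ (n : ℕ) * (1 - q ^ (N * (n : ℕ))) / (1 - q ^ (n : ℕ))) ∧
    1 / qShiftedFactorial q q N *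
        ∑ n ∈ Finset.Icc 1 N,
          qBinomial q N n * ((-1) ^ (n - 1) * (n : ℂ) * q ^ (n * (n + 1) / 2) / (1 - q ^ n)) +
      ∑ n ∈ Finset.Icc 1 N,
        qBinomial q N n * (q ^ (n ^ 2) / qShiftedFactorial q q n) *
          ∑ k ∈ Finset.Icc 1 n, q ^ k / (1 - q ^ k) ^ 2 =
    1 / qShiftedFactorial q q N *
      ∑' n : ℕ+,
        ((n : ℕ) : ℂ) * q ^ (n : ℕ) * (1 - q ^ (N * (n : ℕ))) / (1 - q ^ (n : ℕ)) := by
  have hs := hasSum_pnat_mul_pow_div hq N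
  refine ⟨hs.summable, ?_⟩
  have hI : ∀ (M : ℕ) (g : ℕ → ℂ),
      ∑ n ∈ Finset.Icc 1 M, g n = ∑ n ∈ Finset.range M, g (n + 1) := by
    intro M g
    rw [Finset.range_eq_Ico, Finset.sum_Ico_add' g 0 M 1, zero_add]
    rfl
  rw [hs.tsum_eq, ← qAlternatingSum_add_sum_qDurfeeWeight hq N, mul_add,
    Finset.sum_range_succ' _ N, hI, hI]
  simp only [hI]
  have hP := qShiftedFactorial_self_ne_zero hq N
  congr 1
  · simp [qAlternatingSum, add_assoc, one_add_one_eq_two]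
  · have h0 : qHarmonicTwo q 0 = 0 := by simp [qHarmonicTwo]
    rw [h0, mul_zero, add_zero, Finset.mul_sum]
    refine Finset.sum_congr rfl fun n _ => ?_
    simp only [qDurfeeWeight, qHarmonicTwo]
    field_simp
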